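/- Let $(M,\tau)$ be a tracial von Neumann algebra (a von Neumann algebra with a faithful normal tracial state $\tau$) with separable predual $L^1(M,\tau)$. Here $L^1(M,\tau)$ is the completion of $M$ in the norm $\|x\|_1=\tau(|x|)$, and $x\in L^1(M,\tau)$ is identified with the functional $a\mapsto\tau(xa)$ on $M$. Let $S=\{x\in L^1(M,\tau)_+:\tau(x)=1\}$, and for $x_0\in S$ let $\tau_{x_0}\colon M\to M$ be the map $a\mapsto\tau(x_0a)1$. Let $(\Omega,\mathcal F,\mathbb P)$ be a probability space and let $T\colon\Omega\to\Omega$ be an ergodic invertible bimeasurable measure-preserving transformation. Let $\phi\colon\Omega\times M\to M$ be a weak* random linear operator, that is, $\omega\mapsto\tau(x\phi_\omega(a))$ is measurable for all $a\in M$, $x\in L^1(M,\tau)$, and for all $a,b\in M$, $\alpha\in\mathbb C$ one has $\phi_\omega(\alpha a+b)=\alpha\phi_\omega(a)+\phi_\omega(b)$ almost surely. Suppose that for almost every $\omega$ the map $\phi_\omega$ is linear, normal and positive, and $\phi_\omega(1)$ is invertible. For integers $n\ge m$ put $$\Phi_{n,m}(\omega)=\phi_{T^n\omega}\circ\phi_{T^{n-1}\omega}\circ\cdots\circ\phi_{T^m\omega}.$$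 Suppose that $$\mathbb P\bigl[\exists\, n\ge m \text{ in } \mathbb Z,\ \eta\in(0,1],\ x_0\in S:\ \eta\,\tau_{x_0}\le\Phi_{n,m}\le\eta^{-1}\tau_{x_0}\bigr]>0,$$ where $\alpha\le\beta$ for maps $\alpha,\beta$ on $M$ means $\alpha(a)\le\beta(a)$ for all $a\in M_+$. Then there is a family of ($\|\cdot\|_1$-strongly measurable) random variables $Y_m\colon\Omega\to S$, $m\in\mathbb Z$, such that for every $m\in\mathbb Z$ $$(\phi_{T^{m-1}\omega})_*\cdot Y_m(\omega)=Y_{m-1}(\omega)\qquad\text{and}\qquad Y_m(T^{\pm1}\omega)=Y_{m\pm1}(\omega)$$ almost surely, and for all $a\in M$ and $m\in\mathbb Z$ $$\lim_{n\to\infty}\bigl\|\Phi_{n,m}(1)^{-\frac12}\,\Phi_{n,m}(a)\,\Phi_{n,m}(1)^{-\frac12}-\tau(aY_m)1\bigr\|_\infty=0$$ almost surely. Here $\|\cdot\|_\infty$ is the operator norm, $\phi_*$ denotes the predual map on $L^1(M,\tau)$, determined by $\tau(\phi_*(x)a)=\tau(x\phi(a))$, and $\gamma\cdot x=\gamma(x)/\tau(\gamma(x))$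 is the projective action. -/

import Mathlib

open MeasureTheory Filter Topology
open scoped ComplexOrder

noncomputable section

namespace ErgodicVN

universe u v

variable {H : Type u} [NormedAddCommGroup H] [InnerProductSpace ℂ H] [CompleteSpace H]

/-- The elements of the von Neumann algebra `M ⊆ B(H)`, as a type with its normed `*`-algebra
structure inherited from `B(H)`. -/
abbrev Elem (M : VonNeumannAlgebra H) : Type u := M.toStarSubalgebra

variable {M : VonNeumannAlgebra H}

/-- The positive cone `M₊`: the elements that are positive semidefinite operators. -/
def IsPos (a : Elem M) : Prop := (a : H →L[ℂ] H).IsPositive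

/-- A linear functional on `M` is normal (σ-weakly continuous) if it has the form
`a ↦ ∑ₙ ⟪ηₙ, a ξₙ⟫` with `∑ ‖ξₙ‖² < ∞` and `∑ ‖ηₙ‖² < ∞`. -/
def IsNormalFunctional (f : Elem M →ₗ[ℂ] ℂ) : Prop :=
  ∃ ξ η : ℕ → H, Summable (fun n => ‖ξ n‖ ^ 2) ∧ Summable (fun n => ‖η n‖ ^ 2) ∧
    ∀ a : Elem M, HasSum (fun n => inner ℂ (η n) ((a : H →L[ℂ] H) (ξ n))) (f a)

/-- A linear map on `M` is normal if it is σ-weakly continuous, i.e. if it pulls back the σ-weakly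
continuous functionals to σ-weakly continuous functionals. -/
def IsNormalMap (ψ : Elem M →ₗ[ℂ] Elem M) : Prop :=
  ∀ f : Elem M →ₗ[ℂ] ℂ, IsNormalFunctional f → IsNormalFunctional (f ∘ₗ ψ)

/-- A linear map on `M` is positive if it preserves the positive cone. -/
def IsPositiveMap (ψ : Elem M →ₗ[ℂ] Elem M) : Prop :=
  ∀ a : Elem M, IsPos a → IsPos (ψ a)

/-- `τ` is a faithful normal tracial state on `M`; then `(M, τ)` is a tracial von Neumann
algebra. (Normal functionals are norm-continuous, so `τ` may be bundled as such.) -/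
structure IsFaithfulNormalTracialState (τ : Elem M →L[ℂ] ℂ) : Prop where
  normal : IsNormalFunctional (τ : Elem M →ₗ[ℂ] ℂ)
  nonneg : ∀ a : Elem M, IsPos a → 0 ≤ τ a
  map_one : τ 1 = 1
  faithful : ∀ a : Elem M, IsPos a → τ a = 0 → a = 0
  tracial : ∀ a b : Elem M, τ (a * b) = τ (b * a)

/-- The map `x ↦ τ_x = τ(x ·)` from `M` to the Banach dual of `M`. -/
def traceFunctional (τ : Elem M →L[ℂ] ℂ) : Elem M →ₗ[ℂ] StrongDual ℂ (Elem M) where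
  toFun x := τ.comp (ContinuousLinearMap.mul ℂ (Elem M) x)
  map_add' x y := by ext a; simp
  map_smul' c x := by ext a; simp

/-- `L¹(M, τ)`: the completion of `M` for `‖x‖₁ = τ(|x|) = sup {|τ(x a)| : ‖a‖ ≤ 1}`. As
`x ↦ τ_x` is an isometry from `(M, ‖·‖₁)` into the (complete) Banach dual of `M`, the completion is
the norm closure of the range; `x ∈ L¹(M, τ)` is the functional `a ↦ τ(x a)`. -/
def L1 (τ : Elem M →L[ℂ] ℂ) : Submodule ℂ (StrongDual ℂ (Elem M)) :=
  (LinearMap.range (traceFunctional τ)).topologicalClosure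

/-- The pairing `τ(x a)` of `x ∈ L¹(M, τ)` and `a ∈ M`. -/
def pair {τ : Elem M →L[ℂ] ℂ} (x : L1 τ) (a : Elem M) : ℂ :=
  (x : StrongDual ℂ (Elem M)) a

/-- The state space `S = {x ∈ L¹(M, τ)₊ : τ(x) = 1}`, where `x ∈ L¹(M, τ)₊` means that
`τ(x a) ≥ 0` for all `a ∈ M₊`. -/
def stateSpace (τ : Elem M →L[ℂ] ℂ) : Set (L1 τ) :=
  {x | (∀ a : Elem M, IsPos a → 0 ≤ pair x a) ∧ pair x 1 = 1}

open Classical in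
/-- The predual map `φ_*` of `φ : M → M`: the bounded linear map on `L¹(M, τ)` with
`τ(φ_*(x) a) = τ(x φ(a))`, which is unique, and exists whenever `φ` is linear and normal
(junk value `0` if there is none). -/
def predual (τ : Elem M →L[ℂ] ℂ) (φ : Elem M → Elem M) : L1 τ →L[ℂ] L1 τ :=
  if h : ∃ γ : L1 τ →L[ℂ] L1 τ, ∀ x a, pair (γ x) a = pair x (φ a) then h.choose else 0

/-- The projective action `γ · x = γ(x) / τ(γ(x))`. -/
def projAction {τ : Elem M →L[ℂ] ℂ} (γ : L1 τ →L[ℂ] L1 τ) (x : L1 τ) : L1 τ :=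
  (pair (γ x) 1)⁻¹ • γ x

variable {Ω : Type v} [MeasurableSpace Ω]

/-- Weak* random linear operators on `M`. -/
structure IsWeakStarRLO (τ : Elem M →L[ℂ] ℂ) (μ : Measure Ω) (φ : Ω → Elem M → Elem M) :
    Prop where
  measurable : ∀ (a : Elem M) (x : L1 τ), Measurable fun ω => pair x (φ ω a)
  linear : ∀ (c : ℂ) (a b : Elem M), ∀ᵐ ω ∂μ, φ ω (c • a + b) = c • φ ω a + φ ω b

/-- The random operator `φ` is almost surely a normal positive linear map. -/
def IsNormalPositiveAS (μ : Measure Ω) (φ : Ω → Elem M → Elem M) : Prop :=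
  ∀ᵐ ω ∂μ, ∃ ψ : Elem M →ₗ[ℂ] Elem M, ⇑ψ = φ ω ∧ IsNormalMap ψ ∧ IsPositiveMap ψ

/-- The iterate `T^n ω`, for `n ∈ ℤ`, of an invertible transformation. -/
def iter (T : Ω ≃ᵐ Ω) (n : ℤ) (ω : Ω) : Ω := ((T.toEquiv : Equiv.Perm Ω) ^ n) ω

/-- `φ_{T^{m+k-1} ω} ∘ ⋯ ∘ φ_{T^m ω}`, a composition of `k` maps. -/
def compFrom (φ : Ω → Elem M → Elem M) (T : Ω ≃ᵐ Ω) (m : ℤ) (ω : Ω) : ℕ → Elem M → Elem M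
  | 0 => id
  | k + 1 => φ (iter T (m + k) ω) ∘ compFrom φ T m ω k

/-- The quantum process `Φ_{n,m}(ω) = φ_{T^n ω} ∘ ⋯ ∘ φ_{T^m ω}`, for `n ≥ m`. -/
def process (φ : Ω → Elem M → Elem M) (T : Ω ≃ᵐ Ω) (n m : ℤ) (ω : Ω) : Elem M → Elem M :=
  compFrom φ T m ω (n + 1 - m).toNat

/-- `η τ_{x₀} ≤ ψ ≤ η⁻¹ τ_{x₀}` on the positive cone, where `τ_{x₀}` is the map `a ↦ τ(x₀ a) 1`. -/
def Squeezed {τ : Elem M →L[ℂ] ℂ} (η : ℝ) (x₀ : L1 τ) (ψ : Elem M → Elem M) : Prop :=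
  ∀ a : Elem M, IsPos a →
    IsPos (ψ a - ((η : ℂ) * pair x₀ a) • (1 : Elem M)) ∧
    IsPos ((((η : ℂ)⁻¹) * pair x₀ a) • (1 : Elem M) - ψ a)

/-- `b^{-1/2} a b^{-1/2}`, in `B(H)`, for `b` positive and invertible. -/
def normalize (b a : Elem M) : H →L[ℂ] H :=
  (b : H →L[ℂ] H) ^ (-(1 / 2) : ℝ) * (a : H →L[ℂ] H) * (b : H →L[ℂ] H) ^ (-(1 / 2) : ℝ)

end ErgodicVN

end

open MeasureTheory Filter Topology
open scoped ComplexOrder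

noncomputable section

namespace ErgodicVN

universe u v

variable {H : Type u} [NormedAddCommGroup H] [InnerProductSpace ℂ H] [CompleteSpace H]
  {M : VonNeumannAlgebra H}

/-! A squeezed block `ψ` forgets its input state up to a constant: `y(ψ a) ≤ η⁻² x(ψ a)` for all
states `x`, `y` and all `a ≥ 0` (`Squeezed.harnack`). If `l ψ(1) ≤ ψ(a) ≤ u ψ(1)`, then a further
block with Harnack constant `K` shrinks the width `u - l` by the factor `1 - K⁻²`
(`Pinched.contract`), and any positive map preserves the bounds. By Poincaré recurrence and
ergodicity, blocks of one fixed length and constant occur infinitely often along almost every orbit.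
Hence `Φ(a)` is caught between multiples of `Φ(1)` whose gap tends to `0`, uniformly for
self-adjoint `a` in the unit ball (`exists_pinched`).

The pinching has two consequences (`exists_limit_state`). The states pulled back along the process
form a Cauchy sequence in `L¹`, with a limit `Y`. Conjugation by `Φ(1)^{-1/2}` turns the pinching
into operator norm convergence to the scalar `τ(aY)`. Passing to the limit in the cocycle identity
gives the equivariance of `Y`, and `Y_m = Y ∘ T^m`.

Two supporting facts are needed. Normal functionals lie in the closure of `M` in its dual, so
predual maps act on `L¹`. Separability of `L¹` reduces the Harnack event to countably many
measurable conditions. -/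

section

/-! ### Vector functionals and normal functionals -/

/-- The vector functional `a ↦ ⟪η, a ξ⟫` on `M`. -/
def vecFunctional (M : VonNeumannAlgebra H) (ξ η : H) : StrongDual ℂ (Elem M) :=
  LinearMap.mkContinuous
    { toFun := fun a => inner ℂ η ((a : H →L[ℂ] H) ξ)
      map_add' := fun a b => by simp
      map_smul' := fun c a => by simp } (‖ξ‖ * ‖η‖) fun a => by
    have h1 := norm_inner_le_norm (𝕜 := ℂ) η ((a : H →L[ℂ] H) ξ)
    have h2 := (a : H →L[ℂ] H).le_opNorm ξ
    have h3 : ‖(a : H →L[ℂ] H)‖ = ‖a‖ := rfl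
    calc _ ≤ ‖η‖ * ‖(a : H →L[ℂ] H) ξ‖ := h1
      _ ≤ ‖η‖ * (‖a‖ * ‖ξ‖) := by rw [h3] at h2; gcongr
      _ = _ := by ring

@[simp]
theorem vecFunctional_apply (ξ η : H) (a : Elem M) :
    vecFunctional M ξ η a = inner ℂ η ((a : H →L[ℂ] H) ξ) := rfl

theorem norm_vecFunctional_le (ξ η : H) : ‖vecFunctional M ξ η‖ ≤ ‖ξ‖ * ‖η‖ :=
  LinearMap.mkContinuous_norm_le _ (by positivity) _

/-- A normal functional is a norm convergent sum of vector functionals. -/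
theorem hasSum_vecFunctional {f : StrongDual ℂ (Elem M)} {ξ η : ℕ → H}
    (hξ : Summable fun n => ‖ξ n‖ ^ 2) (hη : Summable fun n => ‖η n‖ ^ 2)
    (h : ∀ a : Elem M, HasSum (fun n => inner ℂ (η n) ((a : H →L[ℂ] H) (ξ n))) (f a)) :
    HasSum (fun n => vecFunctional M (ξ n) (η n)) f := by
  have hs : Summable fun n => vecFunctional M (ξ n) (η n) := by
    refine Summable.of_norm_bounded (hξ.add hη) fun n => (norm_vecFunctional_le _ _).trans ?_
    nlinarith [sq_nonneg (‖ξ n‖ - ‖η n‖), sq_nonneg (‖ξ n‖ + ‖η n‖)]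
  obtain ⟨g, hg⟩ := hs
  have : g = f := by
    ext a
    exact (hg.mapL (ContinuousLinearMap.apply ℂ ℂ a)).unique (h a)
  rwa [← this]

/-- A continuous functional on the dual of `M` agrees on vector functionals with the evaluation at
an element of `M`. -/
theorem exists_elem_of_dual (M : VonNeumannAlgebra H)
    (F : StrongDual ℂ (StrongDual ℂ (Elem M))) :
    ∃ a : Elem M, ∀ ξ η : H, F (vecFunctional M ξ η) = vecFunctional M ξ η a := by
  let B : H →L⋆[ℂ] H →L[ℂ] ℂ := LinearMap.mkContinuous₂
    (LinearMap.mk₂'ₛₗ (starRingEnd ℂ) (RingHom.id ℂ) (fun η ξ => F (vecFunctional M ξ η))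
      (fun η η' ξ => by
        rw [← map_add]; congr 1; ext a; simp)
      (fun c η ξ => by
        rw [← map_smul]; congr 1; ext a; simp [mul_comm])
      (fun η ξ ξ' => by
        rw [← map_add]; congr 1; ext a; simp)
      (fun c η ξ => by
        rw [RingHom.id_apply, ← map_smul]; congr 1; ext a; simp)) ‖F‖
    (fun η ξ => by
      have h1 := F.le_opNorm (vecFunctional M ξ η)
      have h2 := norm_vecFunctional_le (M := M) ξ η
      calc _ ≤ ‖F‖ * ‖vecFunctional M ξ η‖ := h1
        _ ≤ ‖F‖ * (‖ξ‖ * ‖η‖) := by gcongr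
        _ = _ := by ring)
  have hB (η ξ : H) : B η ξ = F (vecFunctional M ξ η) := rfl
  let A : H →L[ℂ] H := ContinuousLinearMap.adjoint (InnerProductSpace.continuousLinearMapOfBilin B)
  have hA (ξ η : H) : inner ℂ η (A ξ) = F (vecFunctional M ξ η) := by
    rw [← hB, ContinuousLinearMap.adjoint_inner_right,
      InnerProductSpace.continuousLinearMapOfBilin_apply]
  -- Bicommutant theorem: for `b` in the commutant, the vector functionals of `(b ξ, η)` and `(ξ, b*
  -- η)` agree on `M`, so `A` commutes with `b`.
  have hmem : A ∈ M := by
    rw [← M.commutant_commutant, VonNeumannAlgebra.mem_commutant_iff]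
    intro b hb
    rw [VonNeumannAlgebra.mem_commutant_iff] at hb
    ext ξ
    refine ext_inner_left ℂ fun η => ?_
    rw [mul_apply_eq_comp, mul_apply_eq_comp,
      ← ContinuousLinearMap.adjoint_inner_left, hA, hA]
    congr 1
    ext c
    have := congrArg (fun S : H →L[ℂ] H => S ξ) (hb c c.2)
    simp only [mul_apply_eq_comp] at this
    simp [ContinuousLinearMap.adjoint_inner_left, this]
  exact ⟨⟨A, hmem⟩, fun ξ η => (hA ξ η).symm⟩

/-- A self-product `a* a` is positive. -/
theorem isPos_star_mul_self (a : Elem M) : IsPos (star a * a) := by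
  have := ContinuousLinearMap.isPositive_adjoint_comp_self (a : H →L[ℂ] H)
  exact this

variable {τ : Elem M →L[ℂ] ℂ}

/-- Hahn–Banach: a functional on the dual that kills `L¹` acts on vector functionals as evaluation
at some `a ∈ M`. Since each `τ_x` is a norm convergent sum of vector functionals, `τ(x a) = 0` for
all `x`. Taking `x = a*` forces `a = 0` by faithfulness. -/
theorem vecFunctional_mem_L1 (hτ : IsFaithfulNormalTracialState τ) (ξ η : H) :
    vecFunctional M ξ η ∈ L1 τ := by
  by_contra hmem
  have hcl : IsClosed (L1 τ : Set (StrongDual ℂ (Elem M))) :=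
    Submodule.isClosed_topologicalClosure _
  let q : StrongDual ℂ (Elem M) →L[ℂ] StrongDual ℂ (Elem M) ⧸ L1 τ := (L1 τ).mkQL
  have hq : ‖q (vecFunctional M ξ η)‖ ≠ 0 := fun h => hmem (QuotientAddGroup.norm_mk_eq_zero.1 h)
  obtain ⟨g, -, hg⟩ := exists_dual_vector ℂ (q (vecFunctional M ξ η)) hq
  obtain ⟨a, ha⟩ := exists_elem_of_dual M (g.comp q)
  obtain ⟨ξs, ηs, hξ, hη, hs⟩ := hτ.normal
  have hker (f : StrongDual ℂ (Elem M)) (hf : f ∈ L1 τ) : q f = 0 :=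
    (Submodule.Quotient.mk_eq_zero _).2 hf
  have hzero (x : Elem M) : τ (x * a) = 0 := by
    have h1 : HasSum (fun n => vecFunctional M ((x : H →L[ℂ] H) (ξs n)) (ηs n))
        (traceFunctional τ x) := by
      refine hasSum_vecFunctional ?_ hη fun b => ?_
      · refine Summable.of_nonneg_of_le (fun _ => by positivity) (fun n => ?_)
          (hξ.mul_left (‖(x : H →L[ℂ] H)‖ ^ 2))
        rw [← mul_pow]
        gcongr
        exact (x : H →L[ℂ] H).le_opNorm _
      · have : traceFunctional τ x b = τ (b * x) := hτ.tracial x b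
        rw [this]
        exact hs (b * x)
    have h2 := h1.mapL (g.comp q)
    have h3 := h1.mapL (ContinuousLinearMap.apply ℂ ℂ a)
    simp only [ha] at h2
    have h4 := h2.unique h3
    have h5 : (g.comp q) (traceFunctional τ x) = 0 := by
      rw [ContinuousLinearMap.comp_apply, hker _ (Submodule.le_topologicalClosure _ ⟨x, rfl⟩),
        map_zero]
    rw [h5] at h4
    exact h4.symm
  have ha0 : a = 0 := by
    have h := hτ.faithful _ (isPos_star_mul_self a) (hzero (star a))
    have h' : star (a : H →L[ℂ] H) * (a : H →L[ℂ] H) = 0 := congrArg Subtype.val h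
    exact Subtype.ext (CStarRing.star_mul_self_eq_zero_iff _ |>.1 h')
  have h1 := ha ξ η
  rw [ha0, map_zero, ContinuousLinearMap.comp_apply, hg] at h1
  exact hq (Complex.ofReal_eq_zero.1 h1)

/-- Normal functionals belong to `L¹(M, τ)`. -/
theorem IsNormalFunctional.mem_L1 (hτ : IsFaithfulNormalTracialState τ)
    {f : StrongDual ℂ (Elem M)} (hf : IsNormalFunctional (f : Elem M →ₗ[ℂ] ℂ)) : f ∈ L1 τ := by
  obtain ⟨ξ, η, hξ, hη, h⟩ := hf
  have hcl : IsClosed (L1 τ : Set (StrongDual ℂ (Elem M))) :=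
    Submodule.isClosed_topologicalClosure _
  exact hcl.mem_of_tendsto (hasSum_vecFunctional hξ hη h)
    (Eventually.of_forall fun s => Submodule.sum_mem _ fun n _ => vecFunctional_mem_L1 hτ _ _)

theorem isNormalFunctional_traceFunctional (hτ : IsFaithfulNormalTracialState τ) (x : Elem M) :
    IsNormalFunctional (traceFunctional τ x : Elem M →ₗ[ℂ] ℂ) := by
  obtain ⟨ξs, ηs, hξ, hη, hs⟩ := hτ.normal
  refine ⟨fun n => (x : H →L[ℂ] H) (ξs n), ηs, ?_, hη, fun b => ?_⟩
  · refine Summable.of_nonneg_of_le (fun _ => by positivity) (fun n => ?_)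
      (hξ.mul_left (‖(x : H →L[ℂ] H)‖ ^ 2))
    rw [← mul_pow]
    gcongr
    exact (x : H →L[ℂ] H).le_opNorm _
  · have : traceFunctional τ x b = τ (b * x) := hτ.tracial x b
    show HasSum _ (traceFunctional τ x b)
    rw [this]
    exact hs (b * x)


end

section

/-! ### Positivity -/

theorem IsPos.add {a b : Elem M} (ha : IsPos a) (hb : IsPos b) : IsPos (a + b) :=
  ContinuousLinearMap.IsPositive.add ha hb

theorem IsPos.smul {a : Elem M} (ha : IsPos a) {c : ℝ} (hc : 0 ≤ c) : IsPos ((c : ℂ) • a) :=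
  ContinuousLinearMap.IsPositive.smul_of_nonneg ha (by exact_mod_cast hc)

theorem isPos_one : IsPos (1 : Elem M) := ContinuousLinearMap.isPositive_one

theorem isPos_iff_vecFunctional {a : Elem M} :
    IsPos a ↔ ∀ ξ : H, 0 ≤ vecFunctional M ξ ξ a := by
  refine ⟨fun h ξ => ContinuousLinearMap.IsPositive.inner_nonneg_right h ξ, fun h => ?_⟩
  refine (ContinuousLinearMap.isPositive_iff_complex _).2 fun ξ => ?_
  have h1 := h ξ
  rw [vecFunctional_apply] at h1
  have h2 : inner ℂ ((a : H →L[ℂ] H) ξ) ξ = inner ℂ ξ ((a : H →L[ℂ] H) ξ) := by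
    rw [← inner_conj_symm, Complex.conj_eq_iff_im.2 (Complex.nonneg_iff.1 h1).2.symm]
  rw [h2]
  obtain ⟨h3, h4⟩ := Complex.nonneg_iff.1 h1
  exact ⟨Complex.ext (by simp) (by simpa using h4), h3⟩

variable {τ : Elem M →L[ℂ] ℂ}

/-- The real part of the pairing of `x ∈ L¹(M, τ)` and `a ∈ M`. -/
def rpair (x : L1 τ) (a : Elem M) : ℝ := (pair x a).re

@[simp] theorem pair_add (x : L1 τ) (a b : Elem M) : pair x (a + b) = pair x a + pair x b :=
  map_add _ _ _

@[simp] theorem pair_sub (x : L1 τ) (a b : Elem M) : pair x (a - b) = pair x a - pair x b :=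
  map_sub _ _ _

@[simp] theorem pair_smul (x : L1 τ) (c : ℂ) (a : Elem M) : pair x (c • a) = c * pair x a :=
  map_smul _ _ _

@[simp] theorem rpair_sub (x : L1 τ) (a b : Elem M) : rpair x (a - b) = rpair x a - rpair x b := by
  simp [rpair]

theorem rpair_smul (x : L1 τ) (c : ℝ) (a : Elem M) :
    rpair x ((c : ℂ) • a) = c * rpair x a := by
  rw [rpair, pair_smul, Complex.re_ofReal_mul, rpair]

theorem rpair_one {x : L1 τ} (hx : x ∈ stateSpace τ) : rpair x 1 = 1 := by
  rw [rpair, hx.2, Complex.one_re]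

theorem rpair_nonneg {x : L1 τ} (hx : x ∈ stateSpace τ) {a : Elem M} (ha : IsPos a) :
    0 ≤ rpair x a := (Complex.nonneg_iff.1 (hx.1 a ha)).1

theorem pair_eq_rpair_of_isPos {x : L1 τ} (hx : x ∈ stateSpace τ) {a : Elem M} (ha : IsPos a) :
    pair x a = rpair x a := by
  obtain ⟨-, h⟩ := Complex.nonneg_iff.1 (hx.1 a ha)
  exact Complex.ext rfl (by simpa using h.symm)

/-- Normalized vector functionals are states in `L¹`, so they are available as tests. -/
theorem isPos_of_forall_pair (hτ : IsFaithfulNormalTracialState τ) {a : Elem M}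
    (h : ∀ x ∈ stateSpace τ, 0 ≤ pair x a) : IsPos a := by
  refine isPos_iff_vecFunctional.2 fun ξ => ?_
  rcases eq_or_ne ξ 0 with rfl | hξ
  · simp
  have hn : 0 < ‖ξ‖ := norm_pos_iff.2 hξ
  let c : ℝ := (‖ξ‖ ^ 2)⁻¹
  have hc : 0 < c := by positivity
  have hstate : (c : ℂ) • (⟨_, vecFunctional_mem_L1 hτ ξ ξ⟩ : L1 τ) ∈ stateSpace τ := by
    refine ⟨fun b hb => ?_, ?_⟩
    · have := isPos_iff_vecFunctional.1 hb ξ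
      exact mul_nonneg (by exact_mod_cast hc.le) this
    · show (c : ℂ) * vecFunctional M ξ ξ 1 = 1
      have : vecFunctional M ξ ξ 1 = ((‖ξ‖ ^ 2 : ℝ) : ℂ) := by
        rw [vecFunctional_apply]
        simp [inner_self_eq_norm_sq_to_K]
      rw [this, ← Complex.ofReal_mul, inv_mul_cancel₀ (by positivity), Complex.ofReal_one]
  have h1 : 0 ≤ (c : ℂ) * vecFunctional M ξ ξ a := h _ hstate
  have h2 : vecFunctional M ξ ξ a = ((c⁻¹ : ℝ) : ℂ) * ((c : ℂ) * vecFunctional M ξ ξ a) := by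
    rw [← mul_assoc, ← Complex.ofReal_mul, inv_mul_cancel₀ hc.ne', Complex.ofReal_one, one_mul]
  rw [h2]
  exact mul_nonneg (by exact_mod_cast (inv_pos.2 hc).le) h1

/-- States determine the order among differences of positive elements. -/
theorem isPos_sub_of_forall_rpair (hτ : IsFaithfulNormalTracialState τ) {a b : Elem M}
    (ha : IsPos a) (hb : IsPos b) (h : ∀ x ∈ stateSpace τ, rpair x b ≤ rpair x a) :
    IsPos (a - b) := by
  refine isPos_of_forall_pair hτ fun x hx => ?_
  rw [pair_sub, pair_eq_rpair_of_isPos hx ha, pair_eq_rpair_of_isPos hx hb, ← Complex.ofReal_sub]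
  exact_mod_cast sub_nonneg.2 (h x hx)

theorem isPos_norm_sub {a : Elem M} (ha : star a = a) : IsPos (((‖a‖ : ℝ) : ℂ) • 1 - a) := by
  have h : IsSelfAdjoint (a : H →L[ℂ] H) := congrArg Subtype.val ha
  have := h.le_algebraMap_norm_self
  rw [ContinuousLinearMap.le_def] at this
  exact this

theorem isPos_norm_add {a : Elem M} (ha : star a = a) : IsPos (((‖a‖ : ℝ) : ℂ) • 1 + a) := by
  have := isPos_norm_sub (a := -a) (by rw [star_neg, ha])
  rwa [norm_neg, sub_neg_eq_add] at this

/-- An operator between `-c` and `c` has norm at most `c`. -/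
theorem norm_le_of_isPositive {T : H →L[ℂ] H} {c : ℝ} (hc : 0 ≤ c)
    (h1 : ((c : ℂ) • (1 : H →L[ℂ] H) - T).IsPositive)
    (h2 : ((c : ℂ) • (1 : H →L[ℂ] H) + T).IsPositive) : ‖T‖ ≤ c := by
  have hT : IsSelfAdjoint T := by
    have := h2.isSelfAdjoint.sub h1.isSelfAdjoint
    have e : (c : ℂ) • (1 : H →L[ℂ] H) + T - ((c : ℂ) • (1 : H →L[ℂ] H) - T) = (2 : ℝ) • T := by
      rw [two_smul]; abel
    rw [e] at this
    have h3 := (IsSelfAdjoint.all (2⁻¹ : ℝ)).smul this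
    rwa [smul_smul, inv_mul_cancel₀ two_ne_zero, one_smul] at h3
  rw [ContinuousLinearMap.norm_eq_iSup_rayleighQuotient T hT.isSymmetric]
  refine ciSup_le fun ξ => ?_
  have h3 := h1.re_inner_nonneg_left ξ
  have h4 := h2.re_inner_nonneg_left ξ
  rcases eq_or_ne ξ 0 with rfl | hξ
  · simpa [ContinuousLinearMap.rayleighQuotient] using hc
  have hn : 0 < ‖ξ‖ ^ 2 := by positivity
  simp only [_root_.sub_apply, _root_.add_apply, inner_sub_left,
    inner_add_left, _root_.smul_apply, one_apply_eq_self, map_sub,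
    map_add, inner_smul_left, Complex.conj_ofReal, RCLike.re_to_complex, Complex.re_ofReal_mul] at h3 h4
  have h5 : (inner ℂ ξ ξ : ℂ).re = ‖ξ‖ ^ 2 := by
    rw [inner_self_eq_norm_sq_to_K]; norm_cast
  rw [h5] at h3 h4
  rw [ContinuousLinearMap.rayleighQuotient, abs_le, le_div_iff₀ hn, div_le_iff₀ hn]
  simp only [ContinuousLinearMap.reApplyInnerSelf_apply, RCLike.re_to_complex]
  constructor <;> linarith

theorem norm_le_of_isPos {a : Elem M} {c : ℝ} (hc : 0 ≤ c)
    (h1 : IsPos ((c : ℂ) • 1 - a)) (h2 : IsPos ((c : ℂ) • 1 + a)) : ‖a‖ ≤ c :=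
  norm_le_of_isPositive hc h1 h2

theorem exists_selfAdjoint_decomp (a : Elem M) : ∃ h k : Elem M, star h = h ∧ star k = k ∧
    a = h + Complex.I • k ∧ ‖h‖ ≤ ‖a‖ ∧ ‖k‖ ≤ ‖a‖ := by
  refine ⟨realPart a, imaginaryPart a, (realPart a).2, (imaginaryPart a).2,
    (realPart_add_I_smul_imaginaryPart a).symm, ?_, ?_⟩
  · exact realPart.norm_le a
  · exact imaginaryPart.norm_le a

/-! ### Positive normal maps -/

/-- For self-adjoint `a`, apply `ψ` to `-‖a‖ ≤ a ≤ ‖a‖`; real and imaginary parts cost a factor 2.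
-/
theorem IsPositiveMap.exists_bound {ψ : Elem M →ₗ[ℂ] Elem M} (hψ : IsPositiveMap ψ) :
    ∃ C : ℝ, ∀ a, ‖ψ a‖ ≤ C * ‖a‖ := by
  have key (a : Elem M) (ha : star a = a) : ‖ψ a‖ ≤ ‖ψ 1‖ * ‖a‖ := by
    have h0 : star (ψ 1) = ψ 1 := Subtype.ext (hψ 1 isPos_one).isSelfAdjoint
    have h1 := hψ _ (isPos_norm_sub ha)
    have h2 := hψ _ (isPos_norm_add ha)
    have h3 := (isPos_norm_sub h0).smul (norm_nonneg a)
    rw [map_sub, map_smul] at h1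
    rw [map_add, map_smul] at h2
    refine norm_le_of_isPos (by positivity) ?_ ?_
    · convert h1.add h3 using 1
      push_cast
      module
    · convert h2.add h3 using 1
      push_cast
      module
  refine ⟨‖ψ 1‖ + ‖ψ 1‖, fun a => ?_⟩
  obtain ⟨h, k, hh, hk, e, nh, nk⟩ := exists_selfAdjoint_decomp a
  calc ‖ψ a‖ = ‖ψ h + Complex.I • ψ k‖ := by rw [e, map_add, map_smul]
    _ ≤ ‖ψ h‖ + ‖ψ k‖ := by
        refine (norm_add_le _ _).trans ?_
        rw [norm_smul, Complex.norm_I, one_mul]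
    _ ≤ ‖ψ 1‖ * ‖h‖ + ‖ψ 1‖ * ‖k‖ := add_le_add (key h hh) (key k hk)
    _ ≤ ‖ψ 1‖ * ‖a‖ + ‖ψ 1‖ * ‖a‖ := by gcongr
    _ = _ := by ring

/-- The transpose of `ψ` sends each `τ_x` to a normal functional, hence into `L¹`; continuity
extends this to the closure. -/
theorem exists_predual (hτ : IsFaithfulNormalTracialState τ) {ψ : Elem M →ₗ[ℂ] Elem M}
    (hn : IsNormalMap ψ) (hp : IsPositiveMap ψ) :
    ∃ γ : L1 τ →L[ℂ] L1 τ, ∀ x a, pair (γ x) a = pair x (ψ a) := by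
  let ψc : Elem M →L[ℂ] Elem M := ψ.mkContinuousOfExistsBound hp.exists_bound
  let D : StrongDual ℂ (Elem M) →L[ℂ] StrongDual ℂ (Elem M) :=
    (ContinuousLinearMap.compL ℂ (Elem M) (Elem M) ℂ).flip ψc
  have hD (f : StrongDual ℂ (Elem M)) (hf : f ∈ L1 τ) : D f ∈ L1 τ := by
    have hcl : IsClosed (L1 τ : Set (StrongDual ℂ (Elem M))) :=
      Submodule.isClosed_topologicalClosure _
    have hf' : f ∈ closure (LinearMap.range (traceFunctional τ) : Set (StrongDual ℂ (Elem M))) := hf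
    have : D f ∈ closure (L1 τ : Set (StrongDual ℂ (Elem M))) := by
      refine map_mem_closure D.continuous hf' ?_
      rintro _ ⟨x, rfl⟩
      refine IsNormalFunctional.mem_L1 hτ ?_
      exact hn _ (isNormalFunctional_traceFunctional hτ x)
    rwa [hcl.closure_eq] at this
  exact ⟨(D.comp (L1 τ).subtypeL).codRestrict (L1 τ) fun x => hD x x.2, fun x a => rfl⟩

theorem pair_predual (hτ : IsFaithfulNormalTracialState τ) {ψ : Elem M →ₗ[ℂ] Elem M}
    (hn : IsNormalMap ψ) (hp : IsPositiveMap ψ) (x : L1 τ) (a : Elem M) :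
    pair (predual τ ψ x) a = pair x (ψ a) := by
  have h := exists_predual hτ hn hp
  rw [predual, dif_pos h]
  exact h.choose_spec x a

/-- The trace is a state. -/
theorem stateSpace_nonempty (hτ : IsFaithfulNormalTracialState τ) : (stateSpace τ).Nonempty := by
  refine ⟨⟨traceFunctional τ 1, Submodule.le_topologicalClosure _ ⟨1, rfl⟩⟩, fun a ha => ?_, ?_⟩
  · have : traceFunctional τ 1 a = τ a := congrArg τ (one_mul a)
    exact (hτ.nonneg a ha).trans_eq this.symm
  · have : traceFunctional τ 1 1 = τ 1 := congrArg τ (one_mul 1)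
    exact this.trans hτ.map_one

@[fun_prop]
theorem continuous_pair (a : Elem M) : Continuous fun x : L1 τ => pair x a :=
  (ContinuousLinearMap.apply ℂ ℂ a).continuous.comp continuous_subtype_val

@[fun_prop]
theorem continuous_rpair (a : Elem M) : Continuous fun x : L1 τ => rpair x a :=
  Complex.continuous_re.comp (continuous_pair a)

theorem isClosed_stateSpace : IsClosed (stateSpace τ) := by
  have : stateSpace τ = (⋂ (a : Elem M) (_ : IsPos a), {x | 0 ≤ pair x a}) ∩ {x | pair x 1 = 1} := by
    ext x; simp [stateSpace]
  rw [this]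
  refine IsClosed.inter (isClosed_iInter fun a => isClosed_iInter fun _ => ?_) ?_
  · exact isClosed_le continuous_const (continuous_pair a)
  · exact isClosed_eq (continuous_pair 1) continuous_const

theorem L1_ext {x y : L1 τ} (h : ∀ a, pair x a = pair y a) : x = y :=
  Subtype.ext (ContinuousLinearMap.ext h)

instance : CompleteSpace (L1 τ) :=
  (Submodule.isClosed_topologicalClosure (LinearMap.range (traceFunctional τ))).completeSpace_coe

end

section

/-! ### Regular maps and their action on states -/

/-- A normal positive linear map with `ψ 1` bounded below by a positive scalar. -/
structure IsRegular (ψ : Elem M →ₗ[ℂ] Elem M) : Prop where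
  normal : IsNormalMap ψ
  positive : IsPositiveMap ψ
  bounded_below : ∃ ε : ℝ, 0 < ε ∧ IsPos (ψ 1 - (ε : ℂ) • 1)

theorem exists_isPos_sub_smul_one {b : Elem M} (hb : IsPos b) (hu : IsUnit b) :
    ∃ ε : ℝ, 0 < ε ∧ IsPos (b - (ε : ℂ) • 1) := by
  have hu' : IsUnit (b : H →L[ℂ] H) := hu.map M.toStarSubalgebra.subtype
  have h0 : (0 : H →L[ℂ] H) ≤ b := (ContinuousLinearMap.nonneg_iff_isPositive _).2 hb
  rcases subsingleton_or_nontrivial H with hH | hH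
  · exact ⟨1, one_pos, isPos_iff_vecFunctional.2 fun ξ => by
      rw [Subsingleton.elim ξ 0]; simp⟩
  obtain ⟨r, hr, h⟩ := (CFC.exists_pos_algebraMap_le_iff (a := (b : H →L[ℂ] H)) h0.isSelfAdjoint).2
    fun x hx => lt_of_le_of_ne (spectrum_nonneg_of_nonneg h0 hx) fun h =>
      spectrum.zero_notMem ℝ hu' (h ▸ hx)
  exact ⟨r, hr, (ContinuousLinearMap.le_def _ _).1 h⟩

theorem IsRegular.id : IsRegular (LinearMap.id : Elem M →ₗ[ℂ] Elem M) where
  normal f hf := hf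
  positive a ha := ha
  bounded_below := ⟨1, one_pos, by
    simpa using (show IsPos (0 : Elem M) from ContinuousLinearMap.isPositive_zero)⟩

theorem IsRegular.comp {ψ χ : Elem M →ₗ[ℂ] Elem M} (hχ : IsRegular χ) (hψ : IsRegular ψ) :
    IsRegular (χ ∘ₗ ψ) where
  normal f hf := hψ.normal _ (hχ.normal f hf)
  positive a ha := hχ.positive _ (hψ.positive a ha)
  bounded_below := by
    obtain ⟨ε, hε, h⟩ := hψ.bounded_below
    obtain ⟨δ, hδ, h'⟩ := hχ.bounded_below
    refine ⟨ε * δ, by positivity, ?_⟩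
    have h1 := hχ.positive _ h
    rw [map_sub, map_smul] at h1
    convert h1.add (h'.smul hε.le) using 1
    rw [LinearMap.comp_apply]
    push_cast
    module

variable {τ : Elem M →L[ℂ] ℂ} {ψ χ : Elem M →ₗ[ℂ] Elem M} {x y : L1 τ}

theorem IsRegular.rpair_pos (hψ : IsRegular ψ) (hx : x ∈ stateSpace τ) : 0 < rpair x (ψ 1) := by
  obtain ⟨ε, hε, h⟩ := hψ.bounded_below
  have := rpair_nonneg hx h
  rw [rpair_sub, rpair_smul, rpair_one hx] at this
  linarith

theorem IsRegular.pair_one (hψ : IsRegular ψ) (hx : x ∈ stateSpace τ) :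
    pair x (ψ 1) = rpair x (ψ 1) :=
  pair_eq_rpair_of_isPos hx (hψ.positive 1 isPos_one)

theorem pair_projAction (hτ : IsFaithfulNormalTracialState τ) (hψ : IsRegular ψ) (x : L1 τ)
    (a : Elem M) :
    pair (projAction (predual τ ψ) x) a = (pair x (ψ 1))⁻¹ * pair x (ψ a) := by
  rw [← pair_predual hτ hψ.normal hψ.positive, ← pair_predual hτ hψ.normal hψ.positive]
  rfl

theorem rpair_projAction (hτ : IsFaithfulNormalTracialState τ) (hψ : IsRegular ψ)
    (hx : x ∈ stateSpace τ) (a : Elem M) :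
    rpair (projAction (predual τ ψ) x) a = (rpair x (ψ 1))⁻¹ * rpair x (ψ a) := by
  rw [rpair, pair_projAction hτ hψ, hψ.pair_one hx, ← Complex.ofReal_inv, Complex.re_ofReal_mul,
    ← rpair]

theorem projAction_mem (hτ : IsFaithfulNormalTracialState τ) (hψ : IsRegular ψ)
    (hx : x ∈ stateSpace τ) : projAction (predual τ ψ) x ∈ stateSpace τ := by
  have h := hψ.rpair_pos hx
  refine ⟨fun a ha => ?_, ?_⟩
  · rw [pair_projAction hτ hψ, hψ.pair_one hx, pair_eq_rpair_of_isPos hx (hψ.positive a ha)]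
    have := rpair_nonneg hx (hψ.positive a ha)
    exact_mod_cast mul_nonneg (inv_nonneg.2 h.le) this
  · rw [pair_projAction hτ hψ, hψ.pair_one hx]
    exact inv_mul_cancel₀ (by exact_mod_cast h.ne')

/-- Transposition reverses the order of composition, and the intermediate normalizing scalar
cancels. -/
theorem projAction_comp (hτ : IsFaithfulNormalTracialState τ) (hψ : IsRegular ψ)
    (hχ : IsRegular χ) (hx : x ∈ stateSpace τ) :
    projAction (predual τ ψ) (projAction (predual τ χ) x) =
      projAction (predual τ (χ ∘ₗ ψ)) x := by
  refine L1_ext fun a => ?_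
  have h1 : pair x (χ 1) ≠ 0 := by
    rw [hχ.pair_one hx]; exact_mod_cast (hχ.rpair_pos hx).ne'
  rw [pair_projAction hτ hψ, pair_projAction hτ hχ, pair_projAction hτ hχ,
    pair_projAction hτ (hχ.comp hψ), mul_inv, inv_inv, LinearMap.comp_apply, LinearMap.comp_apply]
  field_simp

/-! ### Pinching and contraction -/

/-- `l ψ(1) ≤ ψ(a) ≤ u ψ(1)`. -/
def Pinched (l u : ℝ) (ψ : Elem M →ₗ[ℂ] Elem M) (a : Elem M) : Prop :=
  IsPos (ψ a - (l : ℂ) • ψ 1) ∧ IsPos ((u : ℂ) • ψ 1 - ψ a)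

/-- The Harnack inequality with constant `K` for the states pulled back along `ψ`. -/
def Harnack (τ : Elem M →L[ℂ] ℂ) (K : ℝ) (ψ : Elem M →ₗ[ℂ] Elem M) : Prop :=
  ∀ x ∈ stateSpace τ, ∀ y ∈ stateSpace τ, ∀ a : Elem M, IsPos a →
    rpair y (ψ a) ≤ K * rpair x (ψ a)

theorem Pinched.comp {l u : ℝ} {a : Elem M} (h : Pinched l u ψ a) (hχ : IsPositiveMap χ) :
    Pinched l u (χ ∘ₗ ψ) a := by
  obtain ⟨h1, h2⟩ := h
  have h1 := hχ _ h1
  have h2 := hχ _ h2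
  rw [map_sub, map_smul] at h1 h2
  exact ⟨h1, h2⟩

/-- For every state `y`, `y(χ b) ≥ K⁻¹ x(χ b)` and `y(χ c) ≤ K x(χ c)`; the two uses of Harnack
produce `K²`. -/
theorem Harnack.isPos_sub (hτ : IsFaithfulNormalTracialState τ) {K : ℝ} (hK : 0 < K)
    (hχ : IsRegular χ) (h : Harnack τ K χ) (hx : x ∈ stateSpace τ) {b c : Elem M} (hb : IsPos b)
    (hc : IsPos c) (hc' : 0 < rpair x (χ c)) :
    IsPos (χ b - (((K ^ 2)⁻¹ * (rpair x (χ b) / rpair x (χ c)) : ℝ) : ℂ) • χ c) := by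
  have hb' := rpair_nonneg hx (hχ.positive b hb)
  refine isPos_sub_of_forall_rpair hτ (hχ.positive b hb)
    ((hχ.positive c hc).smul (by positivity)) fun y hy => ?_
  rw [rpair_smul]
  have h1 := h y hy x hx b hb
  have h2 := h x hx y hy c hc
  calc (K ^ 2)⁻¹ * (rpair x (χ b) / rpair x (χ c)) * rpair y (χ c)
      ≤ (K ^ 2)⁻¹ * (rpair x (χ b) / rpair x (χ c)) * (K * rpair x (χ c)) := by gcongr
    _ = K⁻¹ * rpair x (χ b) := by field_simp
    _ ≤ K⁻¹ * (K * rpair y (χ b)) := by gcongr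
    _ = rpair y (χ b) := by field_simp

theorem Pinched.contract (hτ : IsFaithfulNormalTracialState τ) {K : ℝ} (hK : 0 < K)
    (hχ : IsRegular χ) (hψ : IsRegular ψ) (hH : Harnack τ K χ) {l u : ℝ} {a : Elem M}
    (h : Pinched l u ψ a) :
    ∃ l' u', u' - l' = (1 - (K ^ 2)⁻¹) * (u - l) ∧ Pinched l' u' (χ ∘ₗ ψ) a := by
  obtain ⟨x, hx⟩ := stateSpace_nonempty hτ
  have ht : 0 < rpair x (χ (ψ 1)) := (hχ.comp hψ).rpair_pos hx
  have h1 := hH.isPos_sub hτ hK hχ hx h.1 (hψ.positive 1 isPos_one) ht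
  have h2 := hH.isPos_sub hτ hK hχ hx h.2 (hψ.positive 1 isPos_one) ht
  set s := (K ^ 2)⁻¹ * (rpair x (χ (ψ a - (l : ℂ) • ψ 1)) / rpair x (χ (ψ 1))) with hs
  set s' := (K ^ 2)⁻¹ * (rpair x (χ ((u : ℂ) • ψ 1 - ψ a)) / rpair x (χ (ψ 1))) with hs'
  -- The positive elements `ψ a - l ψ 1` and `u ψ 1 - ψ a` add up to `(u - l) ψ 1`, so the gains at
  -- the two ends have a fixed total.
  have hsum : s + s' = (K ^ 2)⁻¹ * (u - l) := by
    rw [hs, hs', map_sub, map_sub, map_smul, map_smul, rpair_sub, rpair_sub, rpair_smul,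
      rpair_smul]
    field_simp
    ring
  refine ⟨l + s, u - s', by linear_combination -hsum, ?_, ?_⟩
  · convert h1 using 1
    rw [map_sub, map_smul, LinearMap.comp_apply, LinearMap.comp_apply]
    push_cast
    module
  · convert h2 using 1
    rw [map_sub, map_smul, LinearMap.comp_apply, LinearMap.comp_apply]
    push_cast
    module

theorem Pinched.rpair_mem (hτ : IsFaithfulNormalTracialState τ) (hψ : IsRegular ψ) {l u : ℝ}
    {a : Elem M} (h : Pinched l u ψ a) (hx : x ∈ stateSpace τ) :
    rpair (projAction (predual τ ψ) x) a ∈ Set.Icc l u := by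
  have h0 := hψ.rpair_pos hx
  have h1 := rpair_nonneg hx h.1
  have h2 := rpair_nonneg hx h.2
  rw [rpair_sub, rpair_smul] at h1 h2
  rw [rpair_projAction hτ hψ hx, inv_mul_eq_div, Set.mem_Icc, le_div_iff₀ h0, div_le_iff₀ h0]
  constructor <;> linarith

theorem pair_eq_rpair_of_star_eq (hx : x ∈ stateSpace τ) {a : Elem M} (ha : star a = a) :
    pair x a = rpair x a := by
  have h := pair_eq_rpair_of_isPos hx (isPos_norm_sub ha)
  rw [pair_sub, pair_smul, rpair_sub, rpair_smul, hx.2, rpair_one hx, Complex.ofReal_sub] at h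
  simpa using h

theorem norm_le_of_star_eq {z : L1 τ} {C : ℝ} (hC : 0 ≤ C)
    (h : ∀ a : Elem M, star a = a → ‖pair z a‖ ≤ C * ‖a‖) : ‖z‖ ≤ 2 * C := by
  refine ContinuousLinearMap.opNorm_le_bound (z : StrongDual ℂ (Elem M)) (by positivity) fun a => ?_
  obtain ⟨b, c, hb, hc, e, nb, nc⟩ := exists_selfAdjoint_decomp a
  show ‖pair z a‖ ≤ _
  calc ‖pair z a‖ = ‖pair z b + Complex.I * pair z c‖ := by
        conv_lhs => rw [e, pair_add, pair_smul]
    _ ≤ ‖pair z b‖ + ‖pair z c‖ := by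
        refine (norm_add_le _ _).trans ?_
        rw [norm_mul, Complex.norm_I, one_mul]
    _ ≤ C * ‖b‖ + C * ‖c‖ := add_le_add (h b hb) (h c hc)
    _ ≤ C * ‖a‖ + C * ‖a‖ := by gcongr
    _ = _ := by ring

/-! ### The normalized map -/

theorem normalize_add (b a a' : Elem M) :
    normalize b (a + a') = normalize b a + normalize b a' := by
  simp only [normalize, AddMemClass.coe_add, mul_add, add_mul]

theorem normalize_smul (b : Elem M) (c : ℂ) (a : Elem M) :
    normalize b (c • a) = c • normalize b a := by
  simp only [normalize, SetLike.val_smul, mul_smul_comm, smul_mul_assoc]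

theorem normalize_self {b : Elem M} (hb : IsPos b) (hu : ∃ ε : ℝ, 0 < ε ∧ IsPos (b - (ε : ℂ) • 1)) :
    normalize b b = 1 := by
  obtain ⟨ε, hε, h⟩ := hu
  have h0 : (0 : H →L[ℂ] H) ≤ b := (ContinuousLinearMap.nonneg_iff_isPositive _).2 hb
  have h1 : algebraMap ℝ (H →L[ℂ] H) ε ≤ b := (ContinuousLinearMap.le_def _ _).2 h
  have h2 : IsStrictlyPositive (algebraMap ℝ (H →L[ℂ] H) ε) :=
    ⟨algebraMap_nonneg _ hε.le, (IsUnit.mk0 ε hε.ne').map _⟩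
  have h3 : IsStrictlyPositive (b : H →L[ℂ] H) := IsStrictlyPositive.of_le h2 h1
  exact CFC.conjugate_rpow_neg_one_half (b : H →L[ℂ] H) h3

theorem normalize_isPositive {b a : Elem M} (ha : IsPos a) : (normalize b a).IsPositive := by
  have h0 : (0 : H →L[ℂ] H) ≤ a := (ContinuousLinearMap.nonneg_iff_isPositive _).2 ha
  have h1 : (0 : H →L[ℂ] H) ≤ (b : H →L[ℂ] H) ^ (-(1 / 2) : ℝ) := CFC.rpow_nonneg
  exact (ContinuousLinearMap.nonneg_iff_isPositive _).1 (h1.isSelfAdjoint.conjugate_nonneg h0)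

theorem Pinched.norm_normalize_sub_le (hψ : IsRegular ψ) {l u : ℝ} {a : Elem M}
    (h : Pinched l u ψ a) {t : ℝ} (ht : t ∈ Set.Icc l u) :
    ‖normalize (ψ 1) (ψ a) - (t : ℂ) • (1 : H →L[ℂ] H)‖ ≤ u - l := by
  have h0 := hψ.positive 1 isPos_one
  have h1 : normalize (ψ 1) (ψ 1) = 1 := normalize_self h0 hψ.bounded_below
  have key (s : ℝ) (hs : 0 ≤ s) : IsPos ((s : ℂ) • ψ 1) := h0.smul hs
  -- Loosening both bounds to be symmetric about `t` gives `±(N - t) ≤ u - l` after conjugation,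
  -- with `N` the normalized value.
  have h2 := normalize_isPositive (b := ψ 1) (h.1.add (key (u - t) (by linarith [ht.2])))
  have h3 := normalize_isPositive (b := ψ 1) (h.2.add (key (t - l) (by linarith [ht.1])))
  rw [sub_eq_add_neg, ← neg_one_smul ℂ] at h2 h3
  simp only [normalize_add, normalize_smul, h1] at h2 h3
  refine norm_le_of_isPositive (by linarith [ht.1, ht.2]) ?_ ?_
  · convert h3 using 1
    push_cast
    module
  · convert h2 using 1
    push_cast
    module

end

section

/-! ### Compositions of sequences of maps -/

/-- The composition `ψ (n - 1) ∘ ⋯ ∘ ψ 0`. -/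
def compSeq (ψ : ℕ → Elem M →ₗ[ℂ] Elem M) : ℕ → Elem M →ₗ[ℂ] Elem M
  | 0 => LinearMap.id
  | n + 1 => ψ n ∘ₗ compSeq ψ n

theorem compSeq_add (ψ : ℕ → Elem M →ₗ[ℂ] Elem M) (n k : ℕ) :
    compSeq ψ (n + k) = compSeq (fun i => ψ (n + i)) k ∘ₗ compSeq ψ n := by
  induction k with
  | zero => rfl
  | succ k ih => rw [← add_assoc, compSeq, ih]; rfl

theorem isRegular_compSeq {ψ : ℕ → Elem M →ₗ[ℂ] Elem M} (hψ : ∀ n, IsRegular (ψ n)) (n : ℕ) :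
    IsRegular (compSeq ψ n) := by
  induction n with
  | zero => exact IsRegular.id
  | succ n ih => exact (hψ n).comp ih

variable {τ : Elem M →L[ℂ] ℂ} {ψ : ℕ → Elem M →ₗ[ℂ] Elem M} {x : L1 τ}

theorem Pinched.compSeq_mono (hψ : ∀ n, IsRegular (ψ n)) {l u : ℝ} {a : Elem M} {n k : ℕ}
    (hnk : n ≤ k) (h : Pinched l u (compSeq ψ n) a) : Pinched l u (compSeq ψ k) a := by
  obtain ⟨j, rfl⟩ := Nat.exists_eq_add_of_le hnk
  rw [compSeq_add]
  exact h.comp (isRegular_compSeq (fun i => hψ (n + i)) j).positive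

/-- If a Harnack inequality with a fixed constant holds for infinitely many blocks, then `ψ(a)` is
eventually pinched, uniformly in `a`. -/
theorem exists_pinched (hτ : IsFaithfulNormalTracialState τ) (hψ : ∀ n, IsRegular (ψ n))
    {K : ℝ} (hK : 1 ≤ K) {L : ℕ}
    (hH : ∃ᶠ t in atTop, Harnack τ K (compSeq (fun i => ψ (t + i)) L)) {ε : ℝ} (hε : 0 < ε) :
    ∃ N, ∀ a : Elem M, star a = a → ∃ l u, u - l ≤ ε * ‖a‖ ∧
      ∀ n ≥ N, Pinched l u (compSeq ψ n) a := by
  set c := 1 - (K ^ 2)⁻¹ with hc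
  have hc0 : 0 ≤ c := sub_nonneg.2 (inv_le_one_of_one_le₀ (one_le_pow₀ hK))
  have hc1 : c < 1 := by
    have : 0 < (K ^ 2)⁻¹ := by positivity
    linarith
  -- After `j` disjoint Harnack blocks the initial interval `[-‖a‖, ‖a‖]` has shrunk by `c ^ j`. The
  -- time `N` does not depend on `a`.
  have key (j : ℕ) : ∃ N, ∀ a : Elem M, star a = a → ∃ l u, u - l = c ^ j * (2 * ‖a‖) ∧
      ∀ n ≥ N, Pinched l u (compSeq ψ n) a := by
    induction j with
    | zero =>
      refine ⟨0, fun a ha => ⟨-‖a‖, ‖a‖, by ring, fun n hn =>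
        Pinched.compSeq_mono hψ hn ⟨?_, isPos_norm_sub ha⟩⟩⟩
      convert isPos_norm_add ha using 1
      simp only [compSeq, LinearMap.id_coe, id_eq]
      push_cast
      module
    | succ j ih =>
      obtain ⟨N, hN⟩ := ih
      obtain ⟨t, htN, ht⟩ := (frequently_atTop.1 hH) N
      refine ⟨t + L, fun a ha => ?_⟩
      obtain ⟨l, u, hlu, h⟩ := hN a ha
      obtain ⟨l', u', hlu', h'⟩ := (h t htN).contract hτ (by linarith)
        (isRegular_compSeq (fun i => hψ (t + i)) L) (isRegular_compSeq hψ t) ht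
      rw [← compSeq_add] at h'
      exact ⟨l', u', by rw [hlu', hlu, pow_succ]; ring, fun n hn => h'.compSeq_mono hψ hn⟩
  obtain ⟨j, hj⟩ := exists_pow_lt_of_lt_one (show 0 < ε / 2 by positivity) hc1
  obtain ⟨N, hN⟩ := key j
  refine ⟨N, fun a ha => ?_⟩
  obtain ⟨l, u, hlu, h⟩ := hN a ha
  refine ⟨l, u, ?_, h⟩
  rw [hlu]
  calc c ^ j * (2 * ‖a‖) ≤ (ε / 2) * (2 * ‖a‖) := by gcongr
    _ = ε * ‖a‖ := by ring

/-- Convergence of the pulled back states and of the normalized maps along a sequence of maps for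
which a Harnack inequality holds for infinitely many blocks. -/
theorem exists_limit_state (hτ : IsFaithfulNormalTracialState τ) (hψ : ∀ n, IsRegular (ψ n))
    {K : ℝ} (hK : 1 ≤ K) {L : ℕ}
    (hH : ∃ᶠ t in atTop, Harnack τ K (compSeq (fun i => ψ (t + i)) L))
    (hx : x ∈ stateSpace τ) :
    ∃ y ∈ stateSpace τ,
      Tendsto (fun n => projAction (predual τ (compSeq ψ n)) x) atTop (𝓝 y) ∧
      ∀ a, Tendsto (fun n => ‖normalize (compSeq ψ n 1) (compSeq ψ n a) -
        pair y a • (1 : H →L[ℂ] H)‖) atTop (𝓝 0) := by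
  have hreg := isRegular_compSeq hψ
  have hmem (n : ℕ) := projAction_mem hτ (hreg n) hx
  have hcau : CauchySeq fun n => projAction (predual τ (compSeq ψ n)) x := by
    refine Metric.cauchySeq_iff'.2 fun ε hε => ?_
    -- From time `N` on, all pulled back states take values in one interval `[l, u]`. Passing from
    -- self-adjoint to general `a` doubles `ε / 4`, which stays below `ε`.
    obtain ⟨N, hN⟩ := exists_pinched hτ hψ hK hH (show 0 < ε / 4 by positivity)
    refine ⟨N, fun n hn => ?_⟩
    refine (dist_eq_norm (E := L1 τ) _ _).trans_lt ?_
    refine lt_of_le_of_lt (norm_le_of_star_eq (C := ε / 4) (by positivity) fun a ha => ?_)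
      (by linarith)
    obtain ⟨l, u, hlu, h⟩ := hN a ha
    have h1 := (h n hn).rpair_mem hτ (hreg n) hx
    have h2 := (h N le_rfl).rpair_mem hτ (hreg N) hx
    have e : pair (projAction (predual τ (compSeq ψ n)) x -
        projAction (predual τ (compSeq ψ N)) x) a =
        ((rpair (projAction (predual τ (compSeq ψ n)) x) a -
          rpair (projAction (predual τ (compSeq ψ N)) x) a : ℝ) : ℂ) := by
      rw [Complex.ofReal_sub, ← pair_eq_rpair_of_star_eq (hmem n) ha,
        ← pair_eq_rpair_of_star_eq (hmem N) ha]
      rfl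
    rw [e, Complex.norm_real, Real.norm_eq_abs]
    exact (abs_sub_le_iff.2 ⟨by linarith [h1.2, h2.1], by linarith [h1.1, h2.2]⟩ : _ ≤ u - l).trans hlu
  obtain ⟨y, hy⟩ := cauchySeq_tendsto_of_complete hcau
  have hyS : y ∈ stateSpace τ :=
    isClosed_stateSpace.mem_of_tendsto hy (Eventually.of_forall hmem)
  refine ⟨y, hyS, hy, fun a => ?_⟩
  refine Metric.tendsto_atTop.2 fun ε hε => ?_
  set δ := ε / (2 * ‖a‖ + 1) with hδ
  have hδ0 : 0 < δ := by positivity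
  obtain ⟨N, hN⟩ := exists_pinched hτ hψ hK hH hδ0
  refine ⟨N, fun n hn => ?_⟩
  have key (b : Elem M) (hb : star b = b) : ‖normalize (compSeq ψ n 1) (compSeq ψ n b) -
      pair y b • (1 : H →L[ℂ] H)‖ ≤ δ * ‖b‖ := by
    obtain ⟨l, u, hlu, h⟩ := hN b hb
    -- The closed interval also contains the limit value, so the normalized map is compared with
    -- that scalar.
    have hlim : rpair y b ∈ Set.Icc l u := by
      refine isClosed_Icc.mem_of_tendsto (((continuous_rpair b).tendsto y).comp hy) ?_
      filter_upwards [eventually_ge_atTop N] with k hk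
      exact (h k hk).rpair_mem hτ (hreg k) hx
    rw [pair_eq_rpair_of_star_eq hyS hb]
    exact ((h n hn).norm_normalize_sub_le (hreg n) hlim).trans hlu
  obtain ⟨b, c, hb, hc, e, nb, nc⟩ := exists_selfAdjoint_decomp a
  rw [dist_zero_right, norm_norm]
  have e' : normalize (compSeq ψ n 1) (compSeq ψ n a) - pair y a • (1 : H →L[ℂ] H) =
      (normalize (compSeq ψ n 1) (compSeq ψ n b) - pair y b • (1 : H →L[ℂ] H)) +
      Complex.I • (normalize (compSeq ψ n 1) (compSeq ψ n c) - pair y c • (1 : H →L[ℂ] H)) := by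
    conv_lhs => rw [e, map_add, map_smul, normalize_add, normalize_smul, pair_add, pair_smul]
    module
  rw [e']
  calc _ ≤ δ * ‖b‖ + δ * ‖c‖ := by
        refine (norm_add_le _ _).trans ?_
        rw [norm_smul, Complex.norm_I, one_mul]
        exact add_le_add (key b hb) (key c hc)
    _ ≤ δ * ‖a‖ + δ * ‖a‖ := by gcongr
    _ = δ * (2 * ‖a‖) := by ring
    _ < δ * (2 * ‖a‖ + 1) := by gcongr; linarith
    _ = ε := by rw [hδ]; field_simp

end

section

/-! ### Measurability -/

variable {τ : Elem M →L[ℂ] ℂ}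

/-- Weakly measurable maps into the separable space `L¹(M, τ)` are strongly measurable. -/
theorem stronglyMeasurable_of_measurable_pair {Ω : Type v} [MeasurableSpace Ω]
    [TopologicalSpace.SeparableSpace (L1 τ)] {g : Ω → L1 τ}
    (hg : ∀ a, Measurable fun ω => pair (g ω) a) : StronglyMeasurable g := by
  have hsc : SecondCountableTopology (L1 τ) := UniformSpace.secondCountable_of_separable _
  have hball (z : L1 τ) (r : ℝ) : MeasurableSet (g ⁻¹' Metric.closedBall z r) := by
    -- The norm is a supremum over the unit ball of `M`, which need not be norm separable; the
    -- Lindelöf property of `L¹` leaves countably many `a`.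
    obtain ⟨A, hA, hAc, hAU⟩ := TopologicalSpace.isOpen_biUnion_countable
      {a : Elem M | ‖a‖ ≤ 1} (fun a => {w : L1 τ | r < ‖pair w a - pair z a‖}) fun a _ =>
        isOpen_lt continuous_const (by fun_prop)
    have h : g ⁻¹' Metric.closedBall z r =
        (⋃ a ∈ A, {ω | r < ‖pair (g ω) a - pair z a‖})ᶜ := by
      have h1 : (Metric.closedBall z r)ᶜ = ⋃ a ∈ A, {w : L1 τ | r < ‖pair w a - pair z a‖} := by
        rw [hAU]
        ext w
        simp only [Set.mem_compl_iff, Metric.mem_closedBall, not_le, Set.mem_iUnion,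
          Set.mem_ofPred_eq, exists_prop]
        have e : dist w z = ‖((w - z : L1 τ) : StrongDual ℂ (Elem M))‖ :=
          dist_eq_norm (E := L1 τ) w z
        rw [e]
        constructor
        · intro hr
          obtain ⟨a, ha, har⟩ := ContinuousLinearMap.exists_lt_apply_of_lt_opNorm _ hr
          exact ⟨a, ha.le, har⟩
        · rintro ⟨a, ha, har⟩
          exact har.trans_le (ContinuousLinearMap.unit_le_opNorm
            ((w - z : L1 τ) : StrongDual ℂ (Elem M)) a ha)
      rw [← compl_compl (Metric.closedBall z r), h1, Set.preimage_compl, Set.preimage_iUnion₂]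
      rfl
    rw [h]
    exact (MeasurableSet.biUnion hAc fun a _ =>
      measurableSet_lt measurable_const ((hg a).sub_const _).norm).compl
  borelize ↥(L1 τ)
  refine (measurable_of_isOpen fun U hU => ?_).stronglyMeasurable
  obtain ⟨B, hB, hBc, hBU⟩ := TopologicalSpace.isOpen_biUnion_countable
    {p : L1 τ × ℝ | Metric.closedBall p.1 p.2 ⊆ U} (fun p => Metric.ball p.1 p.2) fun p _ =>
      Metric.isOpen_ball
  have h : U = ⋃ p ∈ B, Metric.closedBall p.1 p.2 := by
    refine Set.Subset.antisymm (fun z hz => ?_) (Set.iUnion₂_subset fun p hp => hB hp)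
    obtain ⟨r, hr, hrU⟩ := Metric.nhds_basis_closedBall.mem_iff.1 (hU.mem_nhds hz)
    have hz' : z ∈ ⋃ p ∈ B, Metric.ball p.1 p.2 := by
      rw [hBU]
      exact Set.mem_biUnion (show (z, r) ∈ _ from hrU) (Metric.mem_ball_self hr)
    exact Set.iUnion₂_mono (fun p _ => Metric.ball_subset_closedBall) hz'
  rw [h, Set.preimage_iUnion₂]
  exact MeasurableSet.biUnion hBc fun p _ => hball p.1 p.2

/-- Countably many positive elements of `M` determine the positive cone of `L¹(M, τ)`. -/
theorem exists_countable_determining (τ : Elem M →L[ℂ] ℂ)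
    [TopologicalSpace.SeparableSpace (L1 τ)] :
    ∃ A : Set (Elem M), A.Countable ∧ (∀ a ∈ A, IsPos a) ∧
      ∀ z : L1 τ, (∀ a ∈ A, 0 ≤ rpair z a) → ∀ a, IsPos a → 0 ≤ rpair z a := by
  have hsc : SecondCountableTopology (L1 τ) := UniformSpace.secondCountable_of_separable _
  obtain ⟨A, hA, hAc, hAU⟩ := TopologicalSpace.isOpen_biUnion_countable
    {a : Elem M | IsPos a} (fun a => {z : L1 τ | rpair z a < 0}) fun a _ =>
      isOpen_lt (continuous_rpair a) continuous_const
  refine ⟨A, hAc, hA, fun z hz a ha => ?_⟩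
  by_contra! hneg
  have : z ∈ ⋃ a ∈ A, {z : L1 τ | rpair z a < 0} := by
    rw [hAU]
    exact Set.mem_biUnion (show a ∈ {a : Elem M | IsPos a} from ha) hneg
  simp only [Set.mem_iUnion, Set.mem_ofPred_eq, exists_prop] at this
  obtain ⟨b, hb, hb'⟩ := this
  exact absurd (hz b hb) (not_le.2 hb')

variable {Ω : Type v} [MeasurableSpace Ω]

theorem measurable_rpair_of_pair {f : Ω → Elem M} (hf : ∀ x : L1 τ, Measurable fun ω => pair x (f ω))
    (x : L1 τ) : Measurable fun ω => rpair x (f ω) :=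
  Complex.measurable_re.comp (hf x)

/-- By continuity, the states may be restricted to a dense sequence. For two fixed states the
inequality says that `K γ(x) - γ(y)` is positive in `L¹`, with `γ` the predual map, and countably
many `a` decide this. -/
theorem measurableSet_harnack (hτ : IsFaithfulNormalTracialState τ)
    [TopologicalSpace.SeparableSpace (L1 τ)] {Ψ : Ω → Elem M →ₗ[ℂ] Elem M}
    (hΨ : ∀ ω, IsRegular (Ψ ω)) (hm : ∀ a (x : L1 τ), Measurable fun ω => pair x (Ψ ω a)) (K : ℝ) :
    MeasurableSet {ω | Harnack τ K (Ψ ω)} := by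
  have hsc : SecondCountableTopology (L1 τ) := UniformSpace.secondCountable_of_separable _
  have : Nonempty (stateSpace τ) := (stateSpace_nonempty hτ).to_subtype
  obtain ⟨A, hAc, hA, hdet⟩ := exists_countable_determining τ
  let D : ℕ → stateSpace τ := TopologicalSpace.denseSeq (stateSpace τ)
  have h : {ω | Harnack τ K (Ψ ω)} = ⋂ (i : ℕ) (j : ℕ), ⋂ a ∈ A,
      {ω | rpair (D j).1 (Ψ ω a) ≤ K * rpair (D i).1 (Ψ ω a)} := by
    ext ω
    simp only [Set.mem_ofPred_eq, Set.mem_iInter]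
    refine ⟨fun h i j a ha => h _ (D i).2 _ (D j).2 a (hA a ha), fun h => ?_⟩
    have h1 (i j : ℕ) (a : Elem M) (ha : IsPos a) :
        rpair (D j).1 (Ψ ω a) ≤ K * rpair (D i).1 (Ψ ω a) := by
      let γ := predual τ (Ψ ω)
      have hγ (x : L1 τ) (b : Elem M) : pair (γ x) b = pair x (Ψ ω b) :=
        pair_predual hτ (hΨ ω).normal (hΨ ω).positive x b
      have e (b : Elem M) : rpair ((K : ℂ) • γ (D i).1 - γ (D j).1) b =
          K * rpair (D i).1 (Ψ ω b) - rpair (D j).1 (Ψ ω b) := by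
        have : pair ((K : ℂ) • γ (D i).1 - γ (D j).1) b =
            K * pair (γ (D i).1) b - pair (γ (D j).1) b := rfl
        rw [rpair, this, hγ, hγ, Complex.sub_re, Complex.re_ofReal_mul, rpair, rpair]
      have h2 := hdet ((K : ℂ) • γ (D i).1 - γ (D j).1)
        (fun b hb => by rw [e]; exact sub_nonneg.2 (h i j b hb)) a ha
      rw [e] at h2
      exact sub_nonneg.1 h2
    intro x hx y hy a ha
    refine isClosed_property2 (β := stateSpace τ) (e := D)
      (p := fun x y => rpair y.1 (Ψ ω a) ≤ K * rpair x.1 (Ψ ω a))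
      (TopologicalSpace.denseRange_denseSeq _) ?_ (fun i j => h1 i j a ha) ⟨x, hx⟩ ⟨y, hy⟩
    exact isClosed_le (by fun_prop) (by fun_prop)
  rw [h]
  refine MeasurableSet.iInter fun i => MeasurableSet.iInter fun j =>
    MeasurableSet.biInter hAc fun a _ => ?_
  exact measurableSet_le (measurable_rpair_of_pair (hm a) _)
    ((measurable_rpair_of_pair (hm a) _).const_mul K)

/-- The outermost map is moved onto `x`, where it gives a measurable random element of `L¹`. The
pairing is continuous in that element and measurable in `ω`, hence jointly measurable. -/
theorem measurable_pair_compSeq (hτ : IsFaithfulNormalTracialState τ)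
    [TopologicalSpace.SeparableSpace (L1 τ)] {Ψ : Ω → ℕ → Elem M →ₗ[ℂ] Elem M}
    (hΨ : ∀ ω n, IsRegular (Ψ ω n))
    (hm : ∀ n a (x : L1 τ), Measurable fun ω => pair x (Ψ ω n a)) (n : ℕ) (a : Elem M) (x : L1 τ) :
    Measurable fun ω => pair x (compSeq (Ψ ω) n a) := by
  have hsc : SecondCountableTopology (L1 τ) := UniformSpace.secondCountable_of_separable _
  induction n generalizing x with
  | zero => exact (measurable_const : Measurable fun _ : Ω => pair x a)
  | succ n ih =>
    borelize ↥(L1 τ)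
    have h1 : Measurable (Function.uncurry fun (z : L1 τ) (ω : Ω) => pair z (compSeq (Ψ ω) n a)) :=
      measurable_uncurry_of_continuous_of_measurable (fun ω => continuous_pair _) ih
    have hγ (ω : Ω) (b : Elem M) : pair (predual τ (Ψ ω n) x) b = pair x (Ψ ω n b) :=
      pair_predual hτ (hΨ ω n).normal (hΨ ω n).positive x b
    have h2 : StronglyMeasurable fun ω => predual τ (Ψ ω n) x :=
      stronglyMeasurable_of_measurable_pair fun b => by
        simp only [hγ]
        exact hm n b x
    have h3 := h1.comp (h2.measurable.prodMk measurable_id)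
    convert h3 using 1
    ext ω
    exact (hγ ω _).symm

theorem stronglyMeasurable_projAction (hτ : IsFaithfulNormalTracialState τ)
    [TopologicalSpace.SeparableSpace (L1 τ)] {Ψ : Ω → Elem M →ₗ[ℂ] Elem M}
    (hΨ : ∀ ω, IsRegular (Ψ ω)) (hm : ∀ a (x : L1 τ), Measurable fun ω => pair x (Ψ ω a))
    (x : L1 τ) : StronglyMeasurable fun ω => projAction (predual τ (Ψ ω)) x := by
  refine stronglyMeasurable_of_measurable_pair fun a => ?_
  simp only [pair_projAction hτ (hΨ _)]
  exact (hm 1 x).inv.mul (hm a x)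

/-! ### Recurrence -/

/-- The set of points visiting `E` infinitely often is invariant, so null or conull; Poincaré
recurrence puts almost all of `E` inside it. -/
theorem ae_frequently_mem_of_ergodic {μ : Measure Ω} [IsFiniteMeasure μ] {T : Ω → Ω}
    (hT : Ergodic T μ) {E : Set Ω} (hE : MeasurableSet E) (hE0 : μ E ≠ 0) :
    ∀ᵐ ω ∂μ, ∃ᶠ n in atTop, T^[n] ω ∈ E := by
  let I : Set Ω := {ω | ∃ᶠ n in atTop, T^[n] ω ∈ E}
  have hI : I = limsup (fun n => T^[n] ⁻¹' E) atTop := by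
    ext ω
    rw [Filter.mem_limsup_iff_frequently_mem]
    rfl
  have hIm : MeasurableSet I := by
    rw [hI]
    exact MeasurableSet.measurableSet_limsup fun n => (hT.measurable.iterate n) hE
  have hinv : T ⁻¹' I = I := by
    ext ω
    show (∃ᶠ n in atTop, T^[n] (T ω) ∈ E) ↔ ∃ᶠ n in atTop, T^[n] ω ∈ E
    simp only [← Function.iterate_succ_apply]
    conv_rhs => rw [← map_add_atTop_eq_nat 1, frequently_map]
  rcases hT.toPreErgodic.ae_mem_or_ae_notMem hIm hinv with h | h
  · exact h
  · refine absurd ?_ hE0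
    have h1 := hT.toMeasurePreserving.conservative.ae_mem_imp_frequently_image_mem
      hE.nullMeasurableSet
    rw [measure_eq_zero_iff_ae_notMem]
    filter_upwards [h, h1] with ω h2 h3 h4
    exact h2 (h3 h4)

end

section

/-! ### Iterates and processes -/

section Iter

variable {Ω : Type v} [MeasurableSpace Ω] (T : Ω ≃ᵐ Ω)

theorem iter_add (m n : ℤ) (ω : Ω) : iter T (m + n) ω = iter T m (iter T n ω) := by
  simp [iter, zpow_add]

@[simp] theorem iter_zero (ω : Ω) : iter T 0 ω = ω := by simp [iter]

theorem iter_one (ω : Ω) : iter T 1 ω = T ω := by simp [iter]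

theorem iter_neg_one (ω : Ω) : iter T (-1) ω = T.symm ω := by
  rw [iter, zpow_neg_one]; rfl

theorem iter_natCast (n : ℕ) (ω : Ω) : iter T n ω = T^[n] ω := by
  induction n with
  | zero => simp
  | succ n ih =>
    rw [Nat.cast_succ, add_comm, iter_add, ih, iter_one, Function.iterate_succ_apply']

theorem measurePreserving_iter {μ : Measure Ω} (hT : MeasurePreserving T μ μ) (m : ℤ) :
    MeasurePreserving (iter T m) μ μ := by
  have hs : MeasurePreserving T.symm μ μ := hT.symm T
  induction m with
  | zero => convert MeasurePreserving.id μ using 1; ext ω; simp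
  | succ n ih =>
    convert ih.comp hT using 1; ext ω; rw [iter_add, iter_one, Function.comp_apply]
  | pred n ih =>
    convert ih.comp hs using 1
    ext ω
    rw [sub_eq_add_neg, iter_add, iter_neg_one, Function.comp_apply]

theorem compFrom_eq_compSeq {φ : Ω → Elem M → Elem M} {Ψ : Ω → Elem M →ₗ[ℂ] Elem M} {m : ℤ}
    {ω : Ω} (h : ∀ i : ℤ, φ (iter T i ω) = Ψ (iter T i ω)) (k : ℕ) :
    compFrom φ T m ω k = compSeq (fun i => Ψ (iter T i (iter T m ω))) k := by
  induction k with
  | zero => rfl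
  | succ k ih =>
    rw [compFrom, ih, h, add_comm m, iter_add]
    rfl

end Iter

/-! ### Limit states of a stationary process -/

variable {τ : Elem M →L[ℂ] ℂ} {Ω : Type v} [MeasurableSpace Ω]

/-- Every state sends `ψ a` into `[η τ(x₀ a), η⁻¹ τ(x₀ a)]`. The resulting inequality no longer
involves `x₀`. -/
theorem Squeezed.harnack {η : ℝ} (hη : 0 < η) {x₀ : L1 τ} (hx₀ : x₀ ∈ stateSpace τ)
    {ψ : Elem M →ₗ[ℂ] Elem M} (h : Squeezed η x₀ ψ) : Harnack τ (η ^ 2)⁻¹ ψ := by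
  intro x hx y hy a ha
  obtain ⟨h1, h2⟩ := h a ha
  have h1 := rpair_nonneg hx h1
  have h2 := rpair_nonneg hy h2
  rw [pair_eq_rpair_of_isPos hx₀ ha] at h1 h2
  rw [← Complex.ofReal_mul, rpair_sub, rpair_smul, rpair_one hx] at h1
  rw [← Complex.ofReal_inv, ← Complex.ofReal_mul, rpair_sub, rpair_smul, rpair_one hy] at h2
  calc rpair y (ψ a) ≤ (η ^ 2)⁻¹ * (η * rpair x₀ a) := by
        have e : (η ^ 2)⁻¹ * (η * rpair x₀ a) = η⁻¹ * rpair x₀ a := by field_simp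
        rw [e]; linarith
    _ ≤ (η ^ 2)⁻¹ * rpair x (ψ a) := by gcongr; linarith

theorem Harnack.mono {K K' : ℝ} (hK : K ≤ K') {ψ : Elem M →ₗ[ℂ] Elem M} (hψ : IsPositiveMap ψ)
    (h : Harnack τ K ψ) : Harnack τ K' ψ := fun x hx y hy a ha =>
  (h x hx y hy a ha).trans (mul_le_mul_of_nonneg_right hK (rpair_nonneg hx (hψ a ha)))

theorem exists_limit_states (hτ : IsFaithfulNormalTracialState τ)
    [TopologicalSpace.SeparableSpace (L1 τ)] {μ : Measure Ω} [IsFiniteMeasure μ] {T : Ω ≃ᵐ Ω}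
    (hT : Ergodic T μ) {Ψ : Ω → Elem M →ₗ[ℂ] Elem M} (hΨ : ∀ ω, IsRegular (Ψ ω))
    (hm : ∀ a (x : L1 τ), Measurable fun ω => pair x (Ψ ω a)) {K : ℝ} (hK : 1 ≤ K) {L : ℕ}
    (hpos : μ {ω | Harnack τ K (compSeq (fun i => Ψ (iter T i ω)) L)} ≠ 0) :
    ∃ Y : Ω → stateSpace τ, StronglyMeasurable Y ∧
      (∀ᵐ ω ∂μ, projAction (predual τ (Ψ ω)) (Y (T ω)) = (Y ω : L1 τ)) ∧
      ∀ᵐ ω ∂μ, ∀ a, Tendsto (fun n =>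
        ‖normalize (compSeq (fun i => Ψ (iter T i ω)) n 1)
          (compSeq (fun i => Ψ (iter T i ω)) n a) - pair (Y ω).1 a • (1 : H →L[ℂ] H)‖)
        atTop (𝓝 0) := by
  have hmi (m : ℤ) (a : Elem M) (x : L1 τ) : Measurable fun ω => pair x (Ψ (iter T m ω) a) :=
    (hm a x).comp (measurePreserving_iter T hT.toMeasurePreserving m).measurable
  let C (ω : Ω) (n : ℕ) : Elem M →ₗ[ℂ] Elem M := compSeq (fun i => Ψ (iter T i ω)) n
  have hC (ω : Ω) (n : ℕ) : IsRegular (C ω n) := isRegular_compSeq (fun i => hΨ _) n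
  have hCm (n : ℕ) (a : Elem M) (x : L1 τ) : Measurable fun ω => pair x (C ω n a) :=
    measurable_pair_compSeq hτ (Ψ := fun ω i => Ψ (iter T i ω)) (fun ω i => hΨ _)
      (fun i => hmi i) n a x
  obtain ⟨x₀, hx₀⟩ := stateSpace_nonempty hτ
  let f (n : ℕ) (ω : Ω) : stateSpace τ :=
    ⟨projAction (predual τ (C ω n)) x₀, projAction_mem hτ (hC ω n) hx₀⟩
  have hfm (n : ℕ) : StronglyMeasurable (f n) :=
    (Embedding.comp_stronglyMeasurable_iff Topology.IsEmbedding.subtypeVal).1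
      (stronglyMeasurable_projAction hτ (fun ω => hC ω n) (hCm n) x₀)
  have hne : Nonempty (stateSpace τ) := ⟨⟨x₀, hx₀⟩⟩
  have hcomplete : CompleteSpace (stateSpace τ) := isClosed_stateSpace.completeSpace_coe
  -- Where the sequence diverges this is a default state, so `Y` is defined and measurable
  -- everywhere.
  let Y (ω : Ω) : stateSpace τ := limUnder atTop fun n => f n ω
  have hgood : ∀ᵐ ω ∂μ, Tendsto (fun n => f n ω) atTop (𝓝 (Y ω)) ∧
      ∀ a, Tendsto (fun n => ‖normalize (C ω n 1) (C ω n a) -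
        pair (Y ω).1 a • (1 : H →L[ℂ] H)‖) atTop (𝓝 0) := by
    filter_upwards [ae_frequently_mem_of_ergodic hT
      (measurableSet_harnack hτ (fun ω => hC ω L) (hCm L) K) hpos] with ω hω
    -- The block starting at time `t` along the orbit of `ω` is the initial block at `T^t ω`.
    have hfreq : ∃ᶠ t in atTop, Harnack τ K
        (compSeq (fun i => (fun j : ℕ => Ψ (iter T j ω)) (t + i)) L) := by
      refine hω.mono fun t ht => ?_
      convert ht using 3 with i
      show Ψ (iter T ((t + i : ℕ) : ℤ) ω) = _
      rw [Nat.cast_add, add_comm, iter_add, iter_natCast T t]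
    obtain ⟨y, hyS, hy, hlim⟩ := exists_limit_state hτ (fun i => hΨ (iter T i ω)) hK hfreq hx₀
    have hy' : Tendsto (fun n => f n ω) atTop (𝓝 ⟨y, hyS⟩) := tendsto_subtype_rng.2 hy
    have hYy : Y ω = ⟨y, hyS⟩ := hy'.limUnder_eq
    rw [hYy]
    exact ⟨hy', hlim⟩
  refine ⟨Y, StronglyMeasurable.limUnder hfm, ?_, hgood.mono fun ω h => h.2⟩
  filter_upwards [hgood, hT.toMeasurePreserving.quasiMeasurePreserving.ae hgood] with ω h1 h2
  have hstep (n : ℕ) : projAction (predual τ (Ψ ω)) (f n (T ω)).1 = (f (n + 1) ω).1 := by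
    show projAction (predual τ (Ψ ω)) (projAction (predual τ (C (T ω) n)) x₀) = _
    rw [projAction_comp hτ (hΨ ω) (hC _ _) hx₀]
    have : C (T ω) n ∘ₗ Ψ ω = C ω (n + 1) := by
      have e : (fun i : ℕ => Ψ (iter T i (T ω))) = fun i => Ψ (iter T ((1 + i : ℕ) : ℤ) ω) := by
        ext1 i
        rw [Nat.cast_add, add_comm, iter_add, Nat.cast_one, iter_one]
      simp only [C]
      rw [add_comm n, compSeq_add, e]
      simp [compSeq, LinearMap.comp_id]
    rw [this]
  have hl1 : Tendsto (fun n => (f (n + 1) ω).1) atTop (𝓝 (Y ω).1) :=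
    (tendsto_subtype_rng.1 h1.1).comp (tendsto_add_atTop_nat 1)
  have hl2 : Tendsto (fun n => (f n (T ω)).1) atTop (𝓝 (Y (T ω)).1) := tendsto_subtype_rng.1 h2.1
  -- The projective action is continuous at the limit since regularity keeps its denominator nonzero
  -- there.
  have hcont : ContinuousAt (fun x : L1 τ => projAction (predual τ (Ψ ω)) x) (Y (T ω)).1 := by
    have h0 : pair (predual τ (Ψ ω) (Y (T ω)).1) 1 ≠ 0 := by
      rw [pair_predual hτ (hΨ ω).normal (hΨ ω).positive, (hΨ ω).pair_one (Y (T ω)).2]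
      exact_mod_cast ((hΨ ω).rpair_pos (Y (T ω)).2).ne'
    have hc1 : ContinuousAt (fun x : L1 τ => predual τ (Ψ ω) x) (Y (T ω)).1 :=
      (predual τ (Ψ ω)).continuous.continuousAt
    have hc2 : ContinuousAt (fun x : L1 τ => pair (predual τ (Ψ ω) x) 1) (Y (T ω)).1 :=
      (continuous_pair 1).continuousAt.comp hc1
    exact (hc2.inv₀ h0).smul hc1
  refine tendsto_nhds_unique (hcont.tendsto.comp hl2) ?_
  convert hl1 using 1
  ext1 n
  exact hstep n

/-- A random operator that is almost surely regular agrees almost surely with an everywhere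
regular one. -/
theorem exists_regular_modification {μ : Measure Ω} {φ : Ω → Elem M → Elem M}
    (hφ : IsWeakStarRLO τ μ φ) (hnp : IsNormalPositiveAS μ φ)
    (hinv : ∀ᵐ ω ∂μ, IsUnit (φ ω 1)) :
    ∃ Ψ : Ω → Elem M →ₗ[ℂ] Elem M, (∀ ω, IsRegular (Ψ ω)) ∧
      (∀ a (x : L1 τ), Measurable fun ω => pair x (Ψ ω a)) ∧ ∀ᵐ ω ∂μ, φ ω = Ψ ω := by
  classical
  have hreg : ∀ᵐ ω ∂μ, ∃ ψ : Elem M →ₗ[ℂ] Elem M, IsRegular ψ ∧ φ ω = ψ := by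
    filter_upwards [hnp, hinv] with ω ⟨ψ, hψ, hn, hp⟩ hu
    rw [← hψ] at hu
    exact ⟨ψ, ⟨hn, hp, exists_isPos_sub_smul_one (hp 1 isPos_one) hu⟩, hψ.symm⟩
  -- A measurable conull set is chosen so that replacing the operator by the identity off it
  -- preserves measurability.
  obtain ⟨s, hs, hsm, hsψ⟩ := Eventually.exists_measurable_mem hreg
  choose! ψ hψ hφψ using hsψ
  refine ⟨s.piecewise ψ fun _ => LinearMap.id, fun ω => ?_, fun a x => ?_, ?_⟩
  · by_cases hω : ω ∈ s
    · rw [Set.piecewise_eq_of_mem _ _ _ hω]; exact hψ ω hω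
    · rw [Set.piecewise_eq_of_notMem _ _ _ hω]; exact IsRegular.id
  · have e : (fun ω => pair x (s.piecewise ψ (fun _ => LinearMap.id) ω a)) =
        s.piecewise (fun ω => pair x (φ ω a)) fun _ => pair x a := by
      ext ω
      by_cases hω : ω ∈ s
      · simp [hω, hφψ ω hω]
      · simp [hω]
    rw [e]
    exact (hφ.measurable a x).piecewise hsm measurable_const
  · filter_upwards [hs] with ω hω
    rw [Set.piecewise_eq_of_mem _ _ _ hω, hφψ ω hω]

end

end ErgodicVN

end

open ErgodicVN in
theorem theoremB
    {H : Type*} [NormedAddCommGroup H] [InnerProductSpace ℂ H] [CompleteSpace H]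
    (M : VonNeumannAlgebra H) (τ : Elem M →L[ℂ] ℂ) (hτ : IsFaithfulNormalTracialState τ)
    (hsep : TopologicalSpace.SeparableSpace (L1 τ))
    {Ω : Type*} [MeasurableSpace Ω] (μ : Measure Ω) [IsProbabilityMeasure μ]
    (T : Ω ≃ᵐ Ω) (hT : Ergodic T μ)
    (φ : Ω → Elem M → Elem M) (hφ : IsWeakStarRLO τ μ φ) (hnp : IsNormalPositiveAS μ φ)
    (hinv : ∀ᵐ ω ∂μ, IsUnit (φ ω 1))
    (hsq : 0 < μ {ω | ∃ n m : ℤ, m ≤ n ∧ ∃ η : ℝ, 0 < η ∧ η ≤ 1 ∧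
      ∃ x₀ ∈ stateSpace τ, Squeezed η x₀ (process φ T n m ω)}) :
    ∃ Y : ℤ → Ω → stateSpace τ,
      (∀ m, StronglyMeasurable (Y m)) ∧
      (∀ m, ∀ᵐ ω ∂μ,
        projAction (predual τ (φ (iter T (m - 1) ω))) (Y m ω) = Y (m - 1) ω ∧
        Y m (T ω) = Y (m + 1) ω ∧ Y m (T.symm ω) = Y (m - 1) ω) ∧
      ∀ (a : Elem M) (m : ℤ), ∀ᵐ ω ∂μ,
        Tendsto (fun n : ℤ =>
            ‖normalize (process φ T n m ω 1) (process φ T n m ω a) -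
              pair (Y m ω).1 a • (1 : H →L[ℂ] H)‖)
          atTop (𝓝 0) := by
  obtain ⟨Ψ, hΨ, hm, hae⟩ := exists_regular_modification hφ hnp hinv
  have hiter (m : ℤ) := measurePreserving_iter T hT.toMeasurePreserving m
  have hall : ∀ᵐ ω ∂μ, ∀ m : ℤ, φ (iter T m ω) = Ψ (iter T m ω) :=
    ae_all_iff.2 fun m => (hiter m).quasiMeasurePreserving.ae hae
  have hproc {ω : Ω} (h : ∀ m : ℤ, φ (iter T m ω) = Ψ (iter T m ω)) (n m : ℤ) :
      process φ T n m ω = compSeq (fun i => Ψ (iter T i (iter T m ω))) (n + 1 - m).toNat :=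
    compFrom_eq_compSeq T h _
  -- Rounding `η⁻²` up to `k + 1` covers the squeezing event, up to a null set, by countably many
  -- Harnack events indexed by `m`, `L`, `k`. Invariance of `μ` moves the starting time `m` to `0`,
  -- so one of these events at time `0` has positive measure.
  obtain ⟨L, k, hLk⟩ : ∃ L k : ℕ,
      μ {ω | Harnack τ (k + 1) (compSeq (fun i => Ψ (iter T i ω)) L)} ≠ 0 := by
    by_contra! hzero
    refine hsq.ne' (measure_eq_zero_iff_ae_notMem.2 ?_)
    have hbad : ∀ᵐ ω ∂μ, ∀ (m : ℤ) (L k : ℕ),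
        ¬ Harnack τ (k + 1) (compSeq (fun i => Ψ (iter T i (iter T m ω))) L) :=
      ae_all_iff.2 fun m => (hiter m).quasiMeasurePreserving.ae
        (ae_all_iff.2 fun L => ae_all_iff.2 fun k =>
          measure_eq_zero_iff_ae_notMem.1 (hzero L k))
    filter_upwards [hall, hbad] with ω h1 h2
    rintro ⟨n, m, -, η, hη, -, x₀, hx₀, hs⟩
    rw [hproc h1] at hs
    obtain ⟨k, hk⟩ := exists_nat_ge (η ^ 2)⁻¹
    exact h2 m _ k ((hs.harnack hη hx₀).mono (by linarith)
      (isRegular_compSeq (fun i => hΨ _) _).positive)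
  obtain ⟨Y, hYm, hstep, hlim⟩ := exists_limit_states hτ hT hΨ hm
    (by linarith [k.cast_nonneg (α := ℝ)] : (1 : ℝ) ≤ k + 1) hLk
  refine ⟨fun m ω => Y (iter T m ω), fun m => hYm.comp_measurable (hiter m).measurable,
    fun m => ?_, fun a m => ?_⟩
  · filter_upwards [hall, (hiter (m - 1)).quasiMeasurePreserving.ae hstep] with ω h1 h2
    refine ⟨?_, ?_, ?_⟩
    · rw [h1]
      have e : T (iter T (m - 1) ω) = iter T m ω := by
        rw [← iter_one T (iter T (m - 1) ω), ← iter_add, add_sub_cancel]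
      rwa [e] at h2
    · rw [iter_add, iter_one]
    · rw [sub_eq_add_neg, iter_add, iter_neg_one]
  · filter_upwards [hall, (hiter m).quasiMeasurePreserving.ae hlim] with ω h1 h2
    -- Truncation by `toNat` only affects `n < m - 1`, which does not matter as `n → ∞`.
    have htop : Tendsto (fun n : ℤ => (n + 1 - m).toNat) atTop atTop :=
      tendsto_atTop_atTop.2 fun b => ⟨b + m, fun n hn => by lia⟩
    simp only [hproc h1]
    exact (h2 a).comp htop
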